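/- For positive integers $d,k$ and a finite set $A\subset\mathbb{Z}^d$ let $kA=\{a_1+\dots+a_k : a_1,\dots,a_k\in A\}$ denote the $k$-fold sumset of $A$, and put $$ m_d(k):=\inf\left\{\frac{|kA|}{|A|} \;:\; A\subset\mathbb{Z}^d \text{ finite},\ \{0,1,\dots,k-1\}^d\subseteq A\right\}. $$ Then for all integers $d\ge 1$ and $k\ge 1$, $$ k^{\frac{d(k-1)}{k}}\;\le\; m_d(k)\;\le\;\left(k-1+\frac1k\right)^d . $$ Moreover, for every fixed $d\ge 1$ these bounds are asymptotically sharp as $k\to\infty$: $$ \lim_{k\to\infty}\frac{\left(k-1+\frac1k\right)^d}{k^{\frac{d(k-1)}{k}}}=1, $$ and hence $$ \lim_{k\to\infty}\frac{m_d(k)}{k^{\frac{d(k-1)}{k}}}=\lim_{k\to\infty}\frac{m_d(k)}{\left(k-1+\frac1k\right)^d}=1 . $$ -/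

import Mathlib

open Filter Topology

namespace CubeSumset

/-- The discrete cube `{0, 1, …, k - 1}^d` in `ℤ^d`. -/
noncomputable def cube (d k : ℕ) : Finset (Fin d → ℤ) :=
  Fintype.piFinset fun _ => Finset.Ico (0 : ℤ) (k : ℤ)

/-- The `k`-fold sumset `kA = A + A + ⋯ + A` (`k` summands): all sums `a₁ + ⋯ + aₖ` with every
`aᵢ ∈ A`, repetitions allowed. -/
def kSumset {d : ℕ} (k : ℕ) (A : Finset (Fin d → ℤ)) : Finset (Fin d → ℤ) :=
  (Fintype.piFinset fun _ : Fin k => A).image fun a => ∑ i, a i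

/-- The set of all ratios `|kA| / |A|`, where `A` runs over the finite subsets of `ℤ^d`
that contain the cube `{0, 1, …, k - 1}^d`. -/
def growthRatios (d k : ℕ) : Set ℝ :=
  {r | ∃ A : Finset (Fin d → ℤ), cube d k ⊆ A ∧ r = ((kSumset k A).card : ℝ) / (A.card : ℝ)}

/-- The infimum of `|kA| / |A|` over all finite `A ⊆ ℤ^d` with `{0, 1, …, k - 1}^d ⊆ A`. -/
noncomputable def infGrowth (d k : ℕ) : ℝ := sInf (growthRatios d k)

/-- `infGrowth` is a genuine infimum: the set of ratios is nonempty and bounded below. -/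
theorem isGLB_infGrowth (d k : ℕ) : IsGLB (growthRatios d k) (infGrowth d k) := by
  refine isGLB_csInf ⟨_, cube d k, Finset.Subset.refl _, rfl⟩ ⟨0, ?_⟩
  rintro r ⟨A, -, rfl⟩
  positivity

end CubeSumset

namespace CubeSumset

/-! ### Membership in sumsets and in the cube -/

section Sumset

variable {d : ℕ}

/-! Upper bound: take `A` to be the cube. Lower bound: compressing along each coordinate keeps `|A|`
and the cube and does not increase `|kA|`, so `A` may be taken to be a down-set. Disjoint boxes, one
per `x ∈ A`, then fit inside `kA` in two ways: `k` summands from `A` give side 1 where `x i = 0` and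
`k` elsewhere; one summand from the cube and `k - 1` from `A` give sides `k` and `k - 1`. The
geometric mean of the two volumes with weights `1/k` and `(k-1)/k` is at least `k^(d(k-1)/k)` for
every `x`, because `k^(k-1) ≤ k (k-1)^(k-1)`; weighted AM-GM and summation over `A` finish
(`rpow_mul_card_le_card_kSumset`). -/

theorem mem_kSumset {k : ℕ} {A : Finset (Fin d → ℤ)} {z : Fin d → ℤ} :
    z ∈ kSumset k A ↔ ∃ a : Fin k → Fin d → ℤ, (∀ i, a i ∈ A) ∧ ∑ i, a i = z := by
  simp [kSumset]

theorem mem_kSumset_zero {A : Finset (Fin d → ℤ)} {z : Fin d → ℤ} :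
    z ∈ kSumset 0 A ↔ z = 0 := by
  simp [mem_kSumset, eq_comm]

theorem mem_kSumset_succ {k : ℕ} {A : Finset (Fin d → ℤ)} {z : Fin d → ℤ} :
    z ∈ kSumset (k + 1) A ↔ ∃ x ∈ A, ∃ y ∈ kSumset k A, x + y = z := by
  simp only [mem_kSumset]
  constructor
  · rintro ⟨a, ha, rfl⟩
    exact ⟨a 0, ha 0, _, ⟨fun i => a i.succ, fun i => ha _, rfl⟩, (Fin.sum_univ_succ a).symm⟩
  · rintro ⟨x, hx, y, ⟨a, ha, rfl⟩, rfl⟩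
    refine ⟨Fin.cons x a, fun i => ?_, by simp [Fin.sum_univ_succ]⟩
    refine Fin.cases ?_ (fun j => ?_) i
    · simpa using hx
    · simpa using ha j

theorem mem_cube {k : ℕ} {x : Fin d → ℤ} : x ∈ cube d k ↔ ∀ i, 0 ≤ x i ∧ x i < k := by
  simp [cube]

end Sumset

/-! ### Reduction to down-sets by compression -/

section Compression

open scoped Pointwise

variable {d : ℕ}

/-- The fibre of `A` through `x` in the direction of the `i`-th coordinate. -/
noncomputable def fiber (A : Finset (Fin d → ℤ)) (i : Fin d) (x : Fin d → ℤ) : Finset ℤ :=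
  A.preimage (Function.update x i) (Function.update_injective x i).injOn

theorem mem_fiber {A : Finset (Fin d → ℤ)} {i : Fin d} {x : Fin d → ℤ} {t : ℤ} :
    t ∈ fiber A i x ↔ Function.update x i t ∈ A := by
  simp [fiber]

theorem fiber_update (A : Finset (Fin d → ℤ)) (i : Fin d) (x : Fin d → ℤ) (t : ℤ) :
    fiber A i (Function.update x i t) = fiber A i x := by
  ext s; simp [mem_fiber]

/-- The compression of `A` along the `i`-th coordinate: every fibre in this direction is replaced
by the initial segment of `ℕ` of the same cardinality. -/
noncomputable def compress (i : Fin d) (A : Finset (Fin d → ℤ)) : Finset (Fin d → ℤ) :=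
  A.biUnion fun x => (Finset.Ico (0 : ℤ) ((fiber A i x).card : ℤ)).image (Function.update x i)

theorem mem_compress {i : Fin d} {A : Finset (Fin d → ℤ)} {x : Fin d → ℤ} :
    x ∈ compress i A ↔ 0 ≤ x i ∧ x i < (fiber A i x).card := by
  simp only [compress, Finset.mem_biUnion, Finset.mem_image, Finset.mem_Ico]
  constructor
  · rintro ⟨y, -, t, ht, rfl⟩
    rw [fiber_update]
    simpa using ht
  · rintro ⟨h0, h1⟩
    have hpos : 0 < (fiber A i x).card := by omega
    obtain ⟨t, ht⟩ := Finset.card_pos.1 hpos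
    refine ⟨_, mem_fiber.1 ht, x i, ?_, by simp⟩
    rw [fiber_update]
    exact ⟨h0, h1⟩

theorem fiber_compress (i : Fin d) (A : Finset (Fin d → ℤ)) (x : Fin d → ℤ) :
    fiber (compress i A) i x = Finset.Ico (0 : ℤ) ((fiber A i x).card : ℤ) := by
  ext t
  simp [mem_fiber, mem_compress, fiber_update]

/-- `T` is left free so that `A` and its compression can be summed over the same base points. -/
theorem card_eq_sum_card_fiber (i : Fin d) (A : Finset (Fin d → ℤ)) (T : Finset (Fin d → ℤ))
    (hT : ∀ x ∈ A, Function.update x i 0 ∈ T) (hT0 : ∀ x ∈ T, x i = 0) :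
    A.card = ∑ x ∈ T, (fiber A i x).card := by
  rw [Finset.card_eq_sum_card_fiberwise (f := fun x => Function.update x i 0) (t := T) hT]
  refine Finset.sum_congr rfl fun x hx => ?_
  rw [← Finset.card_image_of_injective (fiber A i x) (Function.update_injective x i)]
  congr 1
  ext y
  simp only [Finset.mem_filter, Finset.mem_image, mem_fiber]
  constructor
  · rintro ⟨hy, rfl⟩
    exact ⟨y i, by simpa using hy, by simp⟩
  · rintro ⟨t, ht, rfl⟩
    refine ⟨ht, ?_⟩
    rw [Function.update_idem, ← hT0 x hx, Function.update_eq_self]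

theorem card_compress (i : Fin d) (A : Finset (Fin d → ℤ)) : (compress i A).card = A.card := by
  have hz : ∀ B : Finset (Fin d → ℤ), ∀ x ∈ B.image fun x => Function.update x i 0, x i = 0 := by
    intro B x hx
    obtain ⟨y, -, rfl⟩ := Finset.mem_image.1 hx
    simp
  rw [card_eq_sum_card_fiber i A ((A ∪ compress i A).image fun x => Function.update x i 0)
      (fun x hx => Finset.mem_image_of_mem _ (Finset.mem_union_left _ hx)) (hz _),
    card_eq_sum_card_fiber i (compress i A)
      ((A ∪ compress i A).image fun x => Function.update x i 0)
      (fun x hx => Finset.mem_image_of_mem _ (Finset.mem_union_right _ hx)) (hz _)]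
  simp [fiber_compress]

/-- Fibres of `A` and `B` add into a fibre of `S`, and `|X + Y| ≥ |X| + |Y| - 1` for nonempty finite
`X, Y ⊆ ℤ`. -/
theorem add_mem_compress {i : Fin d} {A B S : Finset (Fin d → ℤ)}
    (hS : ∀ a ∈ A, ∀ b ∈ B, a + b ∈ S) {x y : Fin d → ℤ} (hx : x ∈ compress i A)
    (hy : y ∈ compress i B) : x + y ∈ compress i S := by
  rw [mem_compress] at *
  have hA : (fiber A i x).Nonempty := Finset.card_pos.1 (by omega)
  have hB : (fiber B i y).Nonempty := Finset.card_pos.1 (by omega)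
  have hsub : fiber A i x + fiber B i y ⊆ fiber S i (x + y) := by
    intro t ht
    obtain ⟨s, hs, u, hu, rfl⟩ := Finset.mem_add.1 ht
    rw [mem_fiber, Function.update_add]
    exact hS _ (mem_fiber.1 hs) _ (mem_fiber.1 hu)
  have h1 := cauchy_davenport_add_of_linearOrder_isCancelAdd hA hB
  have h2 := Finset.card_le_card hsub
  simp only [Pi.add_apply]
  omega

theorem kSumset_compress_subset (i : Fin d) (A : Finset (Fin d → ℤ)) (k : ℕ) :
    kSumset k (compress i A) ⊆ compress i (kSumset k A) := by
  induction k with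
  | zero =>
    intro z hz
    rw [mem_kSumset_zero] at hz
    subst hz
    rw [mem_compress]
    refine ⟨le_rfl, ?_⟩
    have : (0 : ℤ) ∈ fiber (kSumset 0 A) i 0 := by
      rw [mem_fiber, mem_kSumset_zero]
      exact Function.update_eq_self i 0
    have := Finset.card_pos.2 ⟨_, this⟩
    simpa using this
  | succ k ih =>
    intro z hz
    obtain ⟨x, hx, y, hy, rfl⟩ := mem_kSumset_succ.1 hz
    exact add_mem_compress (fun a ha b hb => mem_kSumset_succ.2 ⟨a, ha, b, hb, rfl⟩) hx (ih hy)

theorem card_kSumset_compress_le (i : Fin d) (A : Finset (Fin d → ℤ)) (k : ℕ) :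
    (kSumset k (compress i A)).card ≤ (kSumset k A).card :=
  (Finset.card_le_card (kSumset_compress_subset i A k)).trans (card_compress i _).le

theorem cube_subset_compress {i : Fin d} {A : Finset (Fin d → ℤ)} {k : ℕ} (h : cube d k ⊆ A) :
    cube d k ⊆ compress i A := by
  intro x hx
  rw [mem_cube] at hx
  have hsub : Finset.Ico (0 : ℤ) k ⊆ fiber A i x := by
    intro t ht
    rw [Finset.mem_Ico] at ht
    refine mem_fiber.2 (h (mem_cube.2 fun j => ?_))
    rcases eq_or_ne j i with rfl | hj
    · simpa using ht
    · simpa [hj] using hx j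
  have := Finset.card_le_card hsub
  have := hx i
  rw [mem_compress]
  simp only [Int.card_Ico] at *
  omega

/-- `A` is a down-set in the direction of the `i`-th coordinate, with non-negative entries. -/
def IsCompressed (i : Fin d) (A : Finset (Fin d → ℤ)) : Prop :=
  ∀ x ∈ A, 0 ≤ x i ∧ ∀ t, 0 ≤ t → t ≤ x i → Function.update x i t ∈ A

theorem isCompressed_compress_self (i : Fin d) (A : Finset (Fin d → ℤ)) :
    IsCompressed i (compress i A) := by
  intro x hx
  rw [mem_compress] at hx
  refine ⟨hx.1, fun t h0 ht => ?_⟩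
  rw [mem_compress, fiber_update, Function.update_self]
  omega

/-- Lowering coordinate `i` can only enlarge a `j`-fibre that meets `A`. Hence one pass over the
coordinates suffices. -/
theorem IsCompressed.compress {i : Fin d} {A : Finset (Fin d → ℤ)} (h : IsCompressed i A)
    (j : Fin d) : IsCompressed i (compress j A) := by
  rcases eq_or_ne i j with rfl | hij
  · exact isCompressed_compress_self i A
  intro x hx
  rw [mem_compress] at hx
  constructor
  · obtain ⟨s, hs⟩ := Finset.card_pos.1 (show 0 < (fiber A j x).card by omega)
    simpa [hij] using (h _ (mem_fiber.1 hs)).1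
  · intro t h0 ht
    rw [mem_compress, Function.update_of_ne hij.symm]
    refine ⟨hx.1, hx.2.trans_le ?_⟩
    refine Nat.cast_le.2 (Finset.card_le_card fun s hs => ?_)
    rw [mem_fiber] at hs ⊢
    rw [Function.update_comm hij]
    exact (h _ hs).2 t h0 (by simpa [hij] using ht)

theorem exists_isCompressed (A : Finset (Fin d → ℤ)) (k : ℕ) (hA : cube d k ⊆ A) :
    ∃ B : Finset (Fin d → ℤ), cube d k ⊆ B ∧ B.card = A.card ∧
      (kSumset k B).card ≤ (kSumset k A).card ∧ ∀ i, IsCompressed i B := by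
  suffices H : ∀ s : Finset (Fin d), ∃ B : Finset (Fin d → ℤ), cube d k ⊆ B ∧ B.card = A.card ∧
      (kSumset k B).card ≤ (kSumset k A).card ∧ ∀ i ∈ s, IsCompressed i B by
    simpa using H Finset.univ
  intro s
  induction s using Finset.induction_on with
  | empty => exact ⟨A, hA, rfl, le_rfl, by simp⟩
  | insert j s _ ih =>
    obtain ⟨B, h1, h2, h3, h4⟩ := ih
    refine ⟨compress j B, cube_subset_compress h1, (card_compress j B).trans h2,
      (card_kSumset_compress_le j B k).trans h3, fun i hi => ?_⟩
    rcases Finset.mem_insert.1 hi with rfl | hi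
    · exact isCompressed_compress_self i B
    · exact (h4 i hi).compress j

theorem mem_of_isCompressed {A : Finset (Fin d → ℤ)} (hA : ∀ i, IsCompressed i A)
    {x y : Fin d → ℤ} (hx : x ∈ A) (h0 : 0 ≤ y) (hy : y ≤ x) : y ∈ A := by
  suffices H : ∀ s : Finset (Fin d), (fun i => if i ∈ s then y i else x i) ∈ A by
    simpa using H Finset.univ
  intro s
  induction s using Finset.induction_on with
  | empty => simpa using hx
  | insert j s hj ih =>
    convert (hA j _ ih).2 (y j) (h0 j) (by simpa [hj] using hy j) using 1
    ext i
    rcases eq_or_ne i j with rfl | hij <;> simp [*]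

end Compression

/-! ### Boxes inside the sumset of a down-set -/

section DownSet

variable {d k : ℕ} {A : Finset (Fin d → ℤ)}

theorem mem_kSumset_of_le_mul (hA : ∀ i, IsCompressed i A) {x : Fin d → ℤ} (hx : x ∈ A) (k : ℕ)
    {y : Fin d → ℤ} (h0 : 0 ≤ y) (hy : ∀ i, y i ≤ k * x i) : y ∈ kSumset k A := by
  induction k generalizing y with
  | zero =>
    refine mem_kSumset_zero.2 (le_antisymm (fun i => ?_) h0)
    simpa using hy i
  | succ k ih =>
    have hx0 : 0 ≤ x := fun i => (hA i x hx).1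
    -- Greedy choice: one summand absorbs as much of `y` as fits below `x`.
    refine mem_kSumset_succ.2 ⟨y ⊓ x, mem_of_isCompressed hA hx (le_inf h0 hx0) inf_le_right,
      y - y ⊓ x, ih (sub_nonneg.2 inf_le_left) fun i => ?_, by abel⟩
    have h1 := hy i
    have h2 : 0 ≤ k * x i := mul_nonneg (by positivity) (hx0 i)
    simp only [Pi.sub_apply, Pi.inf_apply]
    push_cast at h1
    rcases le_total (y i) (x i) with h | h
    · rw [inf_eq_left.2 h]; linarith
    · rw [inf_eq_right.2 h]; linarith

theorem mem_kSumset_succ_of_le_mul_add (hA : ∀ i, IsCompressed i A) (hC : cube d (k + 1) ⊆ A)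
    {x : Fin d → ℤ} (hx : x ∈ A) {y : Fin d → ℤ} (h0 : 0 ≤ y) (hy : ∀ i, y i ≤ k * (x i + 1)) :
    y ∈ kSumset (k + 1) A := by
  refine mem_kSumset_succ.2 ⟨y ⊓ fun _ => (k : ℤ), hC (mem_cube.2 fun i => ?_),
      y - y ⊓ fun _ => (k : ℤ), mem_kSumset_of_le_mul hA hx k (sub_nonneg.2 inf_le_left) fun i => ?_,
      by abel⟩
  · have := h0 i
    simp only [Pi.inf_apply, Pi.zero_apply] at *
    push_cast
    omega
  · have h1 := hy i
    have h2 : 0 ≤ k * x i := mul_nonneg (by positivity) (hA i x hx).1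
    simp only [Pi.sub_apply, Pi.inf_apply]
    rcases le_total (y i) (k : ℤ) with h | h
    · rw [inf_eq_left.2 h]; linarith
    · rw [inf_eq_right.2 h]; linarith

/-- The boxes `∏ J (x i)` are pairwise disjoint because the sets `J t`, `t ≥ 0`, are. -/
theorem sum_prod_card_le_card {S : Finset (Fin d → ℤ)} (J : ℤ → Finset ℤ)
    (hJ : ∀ s t u, 0 ≤ s → 0 ≤ t → u ∈ J s → u ∈ J t → s = t) (hA : ∀ x ∈ A, 0 ≤ x)
    (hS : ∀ x ∈ A, ∀ y : Fin d → ℤ, (∀ i, y i ∈ J (x i)) → y ∈ S) :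
    ∑ x ∈ A, ∏ i, (J (x i)).card ≤ S.card := by
  have hdisj : (A : Set (Fin d → ℤ)).PairwiseDisjoint
      fun x => Fintype.piFinset fun i => J (x i) := by
    intro x hx x' hx' hne
    refine Finset.disjoint_left.2 fun y hy hy' => hne ?_
    rw [Fintype.mem_piFinset] at hy hy'
    ext i
    exact hJ _ _ _ (hA x hx i) (hA x' hx' i) (hy i) (hy' i)
  have := Finset.card_biUnion hdisj
  simp only [Fintype.card_piFinset] at this
  rw [← this]
  refine Finset.card_le_card fun y hy => ?_
  obtain ⟨x, hx, hy⟩ := Finset.mem_biUnion.1 hy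
  exact hS x hx y fun i => Fintype.mem_piFinset.1 hy i

theorem sum_prod_le_card_kSumset (hA : ∀ i, IsCompressed i A) (k : ℕ) :
    ∑ x ∈ A, ∏ i, (if x i = 0 then 1 else k) ≤ (kSumset k A).card := by
  have hA0 : ∀ x ∈ A, 0 ≤ x := fun x hx i => (hA i x hx).1
  convert sum_prod_card_le_card (S := kSumset k A)
    (fun t => if t = 0 then {0} else Finset.Ioc (k * (t - 1)) (k * t)) ?_ hA0 ?_ using 4 with x hx i
  · split_ifs
    · simp
    · rw [Int.card_Ioc, show (k : ℤ) * x i - k * (x i - 1) = k by ring, Int.toNat_natCast]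
  · intro s t u hs ht hus hut
    have key : ∀ s t : ℤ, 0 ≤ s → s < t →
        u ∈ (if s = 0 then ({0} : Finset ℤ) else Finset.Ioc ((k : ℤ) * (s - 1)) (k * s)) →
        u ∉ (if t = 0 then ({0} : Finset ℤ) else Finset.Ioc ((k : ℤ) * (t - 1)) (k * t)) := by
      intro s t hs hst h1 h2
      rw [if_neg (by omega), Finset.mem_Ioc] at h2
      have h3 : (k : ℤ) * s ≤ k * (t - 1) := mul_le_mul_of_nonneg_left (by omega) (by positivity)
      split_ifs at h1 with h
      · subst h
        rw [Finset.mem_singleton] at h1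
        linarith [h2.1]
      · rw [Finset.mem_Ioc] at h1
        linarith [h2.1, h1.2]
    rcases lt_trichotomy s t with h | h | h
    · exact absurd hut (key s t hs h hus)
    · exact h
    · exact absurd hus (key t s ht h hut)
  · intro x hx y hy
    have hb : ∀ i, 0 ≤ y i ∧ y i ≤ k * x i := by
      intro i
      have h := hy i
      have h0 := hA0 x hx i
      simp only [Pi.zero_apply] at h0
      split_ifs at h with hi
      · rw [Finset.mem_singleton] at h
        simp [h, hi]
      · rw [Finset.mem_Ioc] at h
        have : 0 ≤ (k : ℤ) * (x i - 1) := mul_nonneg (by positivity) (by omega)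
        exact ⟨by linarith [h.1], h.2⟩
    exact mem_kSumset_of_le_mul hA hx k (fun i => (hb i).1) fun i => (hb i).2

theorem sum_prod_le_card_kSumset_of_cube_subset (hA : ∀ i, IsCompressed i A)
    (hC : cube d (k + 1) ⊆ A) :
    ∑ x ∈ A, ∏ i, (if x i = 0 then k + 1 else k) ≤ (kSumset (k + 1) A).card := by
  have hA0 : ∀ x ∈ A, 0 ≤ x := fun x hx i => (hA i x hx).1
  convert sum_prod_card_le_card (S := kSumset (k + 1) A)
    (fun t => if t = 0 then Finset.Icc 0 (k : ℤ) else Finset.Ioc (k * t) (k * (t + 1)))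
    ?_ hA0 ?_ using 4 with x hx i
  · split_ifs
    · simp
    · rw [Int.card_Ioc, show (k : ℤ) * (x i + 1) - k * x i = k by ring, Int.toNat_natCast]
  · intro s t u hs ht hus hut
    have key : ∀ s t : ℤ, 0 ≤ s → s < t →
        u ∈ (if s = 0 then Finset.Icc 0 (k : ℤ) else Finset.Ioc (k * s) (k * (s + 1))) →
        u ∉ (if t = 0 then Finset.Icc 0 (k : ℤ) else Finset.Ioc (k * t) (k * (t + 1))) := by
      intro s t hs hst h1 h2
      rw [if_neg (by omega), Finset.mem_Ioc] at h2
      have h3 : (k : ℤ) * (s + 1) ≤ k * t := mul_le_mul_of_nonneg_left (by omega) (by positivity)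
      split_ifs at h1 with h
      · subst h
        rw [Finset.mem_Icc] at h1
        linarith [h2.1, h1.2]
      · rw [Finset.mem_Ioc] at h1
        linarith [h2.1, h1.2]
    rcases lt_trichotomy s t with h | h | h
    · exact absurd hut (key s t hs h hus)
    · exact h
    · exact absurd hus (key t s ht h hut)
  · intro x hx y hy
    have hb : ∀ i, 0 ≤ y i ∧ y i ≤ k * (x i + 1) := by
      intro i
      have h := hy i
      have h0 : 0 ≤ (k : ℤ) * x i := mul_nonneg (by positivity) (hA0 x hx i)
      split_ifs at h with hi
      · rw [Finset.mem_Icc] at h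
        simpa [hi] using h
      · rw [Finset.mem_Ioc] at h
        exact ⟨by linarith [h.1], h.2⟩
    exact mem_kSumset_succ_of_le_mul_add hA hC hx (fun i => (hb i).1) fun i => (hb i).2

end DownSet

/-! ### The lower bound by weighted AM-GM -/

section LowerBound

theorem add_one_pow_le_mul_pow (m : ℕ) : (m + 1) ^ m ≤ (m + 1) * m ^ m := by
  induction m with
  | zero => simp
  | succ m ih =>
    have h : (m + 2) ^ m ≤ (m + 1) ^ (m + 1) := by
      rcases Nat.eq_zero_or_pos m with rfl | hm
      · simp
      -- The factor `m ^ m` lets `(m + 2) * m ≤ (m + 1) ^ 2` be used before the induction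
      -- hypothesis.
      refine Nat.le_of_mul_le_mul_right ?_ (pow_pos hm m)
      calc (m + 2) ^ m * m ^ m = ((m + 2) * m) ^ m := (mul_pow _ _ _).symm
        _ ≤ ((m + 1) * (m + 1)) ^ m := Nat.pow_le_pow_left (by nlinarith) m
        _ = (m + 1) ^ m * (m + 1) ^ m := mul_pow _ _ _
        _ ≤ (m + 1) ^ m * ((m + 1) * m ^ m) := Nat.mul_le_mul_left _ ih
        _ = (m + 1) ^ (m + 1) * m ^ m := by ring
    calc (m + 1 + 1) ^ (m + 1) = (m + 2) * (m + 2) ^ m := by ring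
      _ ≤ (m + 2) * (m + 1) ^ (m + 1) := Nat.mul_le_mul_left _ h

theorem rpow_le_rpow_mul_rpow (k : ℕ) :
    ((k : ℝ) + 1) ^ ((k : ℝ) / (k + 1)) ≤
      ((k : ℝ) + 1) ^ ((1 : ℝ) / (k + 1)) * (k : ℝ) ^ ((k : ℝ) / (k + 1)) := by
  have hk : (0 : ℝ) ≤ k := by positivity
  have h : (((k : ℝ) + 1) ^ k) ^ ((1 : ℝ) / (k + 1)) ≤
      (((k : ℝ) + 1) * (k : ℝ) ^ k) ^ ((1 : ℝ) / (k + 1)) :=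
    Real.rpow_le_rpow (by positivity) (by exact_mod_cast add_one_pow_le_mul_pow k) (by positivity)
  rw [Real.mul_rpow (by positivity) (by positivity), ← Real.rpow_natCast, ← Real.rpow_natCast,
    ← Real.rpow_mul (by positivity), ← Real.rpow_mul hk, mul_one_div] at h
  exact h

theorem rpow_mul_card_le_card_kSumset {d k : ℕ} {A : Finset (Fin d → ℤ)}
    (hC : cube d (k + 1) ⊆ A) :
    (((k : ℝ) + 1) ^ ((k : ℝ) / (k + 1))) ^ d * A.card ≤ (kSumset (k + 1) A).card := by
  obtain ⟨B, hB, hcard, hsum, hcomp⟩ := exists_isCompressed A (k + 1) hC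
  have h1 : ∑ x ∈ B, ∏ i, (if x i = 0 then (1 : ℝ) else k + 1) ≤ (kSumset (k + 1) B).card := by
    exact_mod_cast sum_prod_le_card_kSumset hcomp (k + 1)
  have h2 : ∑ x ∈ B, ∏ i, (if x i = 0 then (k : ℝ) + 1 else k) ≤ (kSumset (k + 1) B).card := by
    exact_mod_cast sum_prod_le_card_kSumset_of_cube_subset hcomp hB
  have hk : (0 : ℝ) < (k : ℝ) + 1 := by positivity
  have hw : (1 : ℝ) / (k + 1) + k / (k + 1) = 1 := by rw [← add_div, add_comm, div_self hk.ne']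
  rw [← hcard]
  refine le_trans ?_ (Nat.cast_le.2 hsum)
  calc (((k : ℝ) + 1) ^ ((k : ℝ) / (k + 1))) ^ d * B.card
      = ∑ x ∈ B, ∏ _i : Fin d, ((k : ℝ) + 1) ^ ((k : ℝ) / (k + 1)) := by simp [mul_comm]
    _ ≤ ∑ x ∈ B, ((1 : ℝ) / (k + 1) * ∏ i, (if x i = 0 then (1 : ℝ) else k + 1) +
          k / (k + 1) * ∏ i, (if x i = 0 then (k : ℝ) + 1 else k)) := by
        refine Finset.sum_le_sum fun x _ => ?_
        have hp : ∀ i ∈ Finset.univ, 0 ≤ (if x i = 0 then (1 : ℝ) else k + 1) := by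
          intro i _; split_ifs <;> positivity
        have hq : ∀ i ∈ Finset.univ, 0 ≤ (if x i = 0 then (k : ℝ) + 1 else k) := by
          intro i _; split_ifs <;> positivity
        refine le_trans ?_ (Real.geom_mean_le_arith_mean2_weighted (by positivity) (by positivity)
          (Finset.prod_nonneg hp) (Finset.prod_nonneg hq) hw)
        rw [← Real.finsetProd_rpow _ _ hp, ← Real.finsetProd_rpow _ _ hq, ← Finset.prod_mul_distrib]
        refine Finset.prod_le_prod (fun i _ => by positivity) fun i _ => ?_
        -- Equality holds at a zero coordinate; a nonzero one needs `rpow_le_rpow_mul_rpow`.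
        split_ifs
        · simp
        · exact rpow_le_rpow_mul_rpow k
    _ = (1 : ℝ) / (k + 1) * ∑ x ∈ B, ∏ i, (if x i = 0 then (1 : ℝ) else k + 1) +
          k / (k + 1) * ∑ x ∈ B, ∏ i, (if x i = 0 then (k : ℝ) + 1 else k) := by
        rw [Finset.sum_add_distrib, Finset.mul_sum, Finset.mul_sum]
    _ ≤ (1 : ℝ) / (k + 1) * (kSumset (k + 1) B).card + k / (k + 1) * (kSumset (k + 1) B).card := by
        gcongr
    _ = (kSumset (k + 1) B).card := by rw [← add_mul, hw, one_mul]

theorem rpow_le_infGrowth (d k : ℕ) (hk : 1 ≤ k) :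
    (k : ℝ) ^ ((d : ℝ) * ((k : ℝ) - 1) / (k : ℝ)) ≤ infGrowth d k := by
  refine (isGLB_infGrowth d k).2 ?_
  rintro r ⟨A, hA, rfl⟩
  obtain ⟨m, rfl⟩ := Nat.exists_eq_add_of_le' hk
  have h0 : (0 : Fin d → ℤ) ∈ A := hA (mem_cube.2 fun i => ⟨le_rfl, by simp⟩)
  have hpos : (0 : ℝ) < A.card := Nat.cast_pos.2 (Finset.card_pos.2 ⟨_, h0⟩)
  rw [le_div_iff₀ hpos]
  refine le_trans (le_of_eq ?_) (rpow_mul_card_le_card_kSumset hA)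
  rw [← Real.rpow_mul_natCast (by positivity)]
  push_cast
  congr 2
  ring

end LowerBound

/-! ### The upper bound from the cube -/

section UpperBound

theorem card_kSumset_cube_le (d k : ℕ) :
    (kSumset k (cube d k)).card ≤ (k * (k - 1) + 1) ^ d := by
  have hsub : kSumset k (cube d k) ⊆
      Fintype.piFinset fun _ : Fin d => Finset.Ico (0 : ℤ) ((k * (k - 1) + 1 : ℕ) : ℤ) := by
    intro z hz
    obtain ⟨a, ha, rfl⟩ := mem_kSumset.1 hz
    refine Fintype.mem_piFinset.2 fun i => Finset.mem_Ico.2 ?_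
    rw [Finset.sum_apply]
    refine ⟨Finset.sum_nonneg fun j _ => (mem_cube.1 (ha j) i).1, ?_⟩
    have h : ∑ j : Fin k, a j i ≤ ∑ _j : Fin k, ((k - 1 : ℕ) : ℤ) :=
      Finset.sum_le_sum fun j _ => by have := mem_cube.1 (ha j) i; omega
    simp only [Finset.sum_const, Finset.card_univ, Fintype.card_fin, nsmul_eq_mul] at h
    push_cast
    linarith
  have h := Finset.card_le_card hsub
  rwa [Fintype.card_piFinset_const, Int.card_Ico, sub_zero, Int.toNat_natCast] at h

theorem infGrowth_le (d k : ℕ) (hk : 1 ≤ k) :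
    infGrowth d k ≤ ((k : ℝ) - 1 + 1 / (k : ℝ)) ^ d := by
  refine ((isGLB_infGrowth d k).1 ⟨cube d k, Finset.Subset.refl _, rfl⟩).trans ?_
  have hk0 : (0 : ℝ) < k := by exact_mod_cast hk
  have hcard : ((cube d k).card : ℝ) = (k : ℝ) ^ d := by simp [cube]
  have h : ((kSumset k (cube d k)).card : ℝ) ≤ ((k : ℝ) * (k - 1) + 1) ^ d := by
    have := card_kSumset_cube_le d k
    rw [← Nat.cast_le (α := ℝ)] at this
    push_cast [hk] at this
    exact this
  rw [hcard, div_le_iff₀ (by positivity), ← mul_pow]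
  refine h.trans (le_of_eq ?_)
  congr 1
  field_simp

end UpperBound

/-! ### Asymptotic sharpness -/

section Limit

theorem tendsto_upper_div_lower (d : ℕ) :
    Tendsto (fun k : ℕ => ((k : ℝ) - 1 + 1 / (k : ℝ)) ^ d /
      (k : ℝ) ^ ((d : ℝ) * ((k : ℝ) - 1) / (k : ℝ))) atTop (𝓝 1) := by
  have h1 : Tendsto (fun k : ℕ => (k : ℝ) ^ ((1 : ℝ) / k)) atTop (𝓝 1) :=
    tendsto_rpow_div.comp tendsto_natCast_atTop_atTop
  have h2 : Tendsto (fun k : ℕ => (1 : ℝ) / k) atTop (𝓝 0) := tendsto_one_div_atTop_nhds_zero_nat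
  -- For `k ≥ 1` the quotient of the bounds is the `d`-th power of `(1 - 1/k + 1/k²) k^(1/k)`.
  have h3 : Tendsto (fun k : ℕ => ((1 - (1 : ℝ) / k + (1 : ℝ) / k * ((1 : ℝ) / k)) *
      (k : ℝ) ^ ((1 : ℝ) / k)) ^ d) atTop (𝓝 1) := by
    simpa using ((((tendsto_const_nhds (x := (1 : ℝ))).sub h2).add (h2.mul h2)).mul h1).pow d
  refine h3.congr' ?_
  filter_upwards [eventually_ge_atTop 1] with k hk
  have hk0 : (0 : ℝ) < k := by exact_mod_cast hk
  have hexp : (d : ℝ) * ((k : ℝ) - 1) / k = (1 - 1 / k) * (d : ℕ) := by field_simp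
  rw [hexp, Real.rpow_mul_natCast hk0.le, ← div_pow, Real.rpow_sub hk0, Real.rpow_one]
  congr 1
  have := Real.rpow_pos_of_pos hk0 (1 / (k : ℝ))
  field_simp

end Limit

end CubeSumset

theorem theorem1p5 (d : ℕ) (hd : 1 ≤ d) :
    (∀ k : ℕ, 1 ≤ k →
      (k : ℝ) ^ ((d : ℝ) * ((k : ℝ) - 1) / (k : ℝ)) ≤ CubeSumset.infGrowth d k ∧
      CubeSumset.infGrowth d k ≤ ((k : ℝ) - 1 + 1 / (k : ℝ)) ^ d) ∧
    Tendsto (fun k : ℕ => ((k : ℝ) - 1 + 1 / (k : ℝ)) ^ d /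
      (k : ℝ) ^ ((d : ℝ) * ((k : ℝ) - 1) / (k : ℝ))) atTop (𝓝 1) ∧
    Tendsto (fun k : ℕ => CubeSumset.infGrowth d k /
      (k : ℝ) ^ ((d : ℝ) * ((k : ℝ) - 1) / (k : ℝ))) atTop (𝓝 1) ∧
    Tendsto (fun k : ℕ => CubeSumset.infGrowth d k /
      ((k : ℝ) - 1 + 1 / (k : ℝ)) ^ d) atTop (𝓝 1) := by
  have hU := CubeSumset.tendsto_upper_div_lower d
  have hpos : ∀ k : ℕ, 1 ≤ k → 0 < (k : ℝ) ^ ((d : ℝ) * ((k : ℝ) - 1) / (k : ℝ)) := fun k hk =>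
    Real.rpow_pos_of_pos (by exact_mod_cast hk) _
  have hL : Tendsto (fun k : ℕ => CubeSumset.infGrowth d k /
      (k : ℝ) ^ ((d : ℝ) * ((k : ℝ) - 1) / (k : ℝ))) atTop (𝓝 1) := by
    refine tendsto_of_tendsto_of_tendsto_of_le_of_le' tendsto_const_nhds hU ?_ ?_
    · filter_upwards [eventually_ge_atTop 1] with k hk
      rw [le_div_iff₀ (hpos k hk), one_mul]
      exact CubeSumset.rpow_le_infGrowth d k hk
    · filter_upwards [eventually_ge_atTop 1] with k hk
      exact div_le_div_of_nonneg_right (CubeSumset.infGrowth_le d k hk) (hpos k hk).le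
  refine ⟨fun k hk => ⟨CubeSumset.rpow_le_infGrowth d k hk, CubeSumset.infGrowth_le d k hk⟩,
    hU, hL, ?_⟩
  -- The common denominator, the lower bound, cancels.
  have h := hL.div hU one_ne_zero
  rw [div_one] at h
  refine h.congr' ?_
  filter_upwards [eventually_ge_atTop 1] with k hk
  exact div_div_div_cancel_right₀ (hpos k hk).ne' _ _
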